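/- Let $p$ be a prime number, let $L$ be a finite extension of $\mathbb{Q}_p$, endowed with the absolute value extending the $p$-adic one (normalized by $|p|=p^{-1}$), and let $A$ be a Fréchet algebra over $L$: an associative unital $L$-algebra endowed with a topology that is Hausdorff and complete, is defined by a countable family of nonarchimedean seminorms on the $L$-vector space $A$, and makes the multiplication $A\times A\to A$ continuous. If $A$ is a division algebra and every element of $A$ is algebraic over $L$, then $A$ is finite-dimensional over $L$. -/

import Mathlib

/-- A Fréchet space over a nonarchimedean field `K`: a `K`-vector space which is Hausdorff and
complete for a topology defined by a countable family of nonarchimedean seminorms (equivalently: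
locally convex, metrizable and complete). The uniform structure is that of the additive group,
so it carries no more information than the topology. -/
structure IsFrechetSpace (K E : Type*) [NormedField K] [AddCommGroup E] [Module K E]
    [UniformSpace E] : Prop where
  isUniformAddGroup : IsUniformAddGroup E
  t2Space : T2Space E
  completeSpace : CompleteSpace E
  exists_seminorms : ∃ q : ℕ → Seminorm K E,
    (∀ n, IsNonarchimedean (q n)) ∧ WithSeminorms q

/-- A Fréchet algebra over `K`: an associative unital `K`-algebra whose underlying space is a
Fréchet space and whose multiplication is (jointly) continuous. The seminorms are not required
to be submultiplicative. -/
structure IsFrechetAlgebra (K A : Type*) [NormedField K] [Ring A] [Algebra K A]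
    [UniformSpace A] : Prop extends IsFrechetSpace K A where
  continuousMul : ContinuousMul A

/-! Algebraicity covers `A` by the closed sets of elements whose first `n` powers are linearly
dependent, so by Baire one of them has an interior point `a`. On a line through `a`, independence is
detected by a nonzero polynomial in the parameter unless it fails everywhere; as it fails near `a`,
it fails on all of `A`, and degrees are bounded. In characteristic zero, the primitive element
theorem then shows that an element of maximal degree generates a field containing its own
centralizer. A division algebra has dimension at most `dim S` over the centralizer of a
finite-dimensional subalgebra `S`, hence is finite-dimensional here. -/

open Polynomial in
/-- Linear functionals of the powers of a point on a line depend polynomially on the parameter. -/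
theorem exists_polynomial_eval_eq_apply_add_smul_pow {K A : Type*} [Field K] [Ring A] [Algebra K A]
    (a b : A) (i : ℕ) (φ : A →ₗ[K] K) :
    ∃ P : K[X], ∀ t : K, P.eval t = φ ((a + t • b) ^ i) := by
  induction i generalizing φ with
  | zero => exact ⟨C (φ 1), fun t => by simp⟩
  | succ i ih =>
    obtain ⟨P, hP⟩ := ih (φ ∘ₗ LinearMap.mulRight K a)
    obtain ⟨Q, hQ⟩ := ih (φ ∘ₗ LinearMap.mulRight K b)
    refine ⟨P + X * Q, fun t => ?_⟩
    simp [hP, hQ, pow_succ, mul_add]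

/-- Linear independence of the powers holds for all but finitely many points of a line, as soon as
it holds for one of them. -/
theorem finite_setOf_not_linearIndependent_add_smul_pow {K A : Type*} [Field K] [Ring A]
    [Algebra K A] (a b : A) (n : ℕ) (t₁ : K)
    (h : LinearIndependent K fun i : Fin n => (a + t₁ • b) ^ (i : ℕ)) :
    {t : K | ¬ LinearIndependent K fun i : Fin n => (a + t • b) ^ (i : ℕ)}.Finite := by
  -- The coordinates `g` send the powers at `t₁` to the standard basis, so the determinant of the
  -- coordinates of the powers is a polynomial in `t` with value `1` at `t₁`. Off its roots the
  -- powers are independent.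
  obtain ⟨g, hg⟩ := LinearMap.exists_leftInverse_of_injective
    (Fintype.linearCombination K fun i : Fin n => (a + t₁ • b) ^ (i : ℕ))
    (LinearMap.ker_eq_bot.2 (linearIndependent_iff_injective_fintypeLinearCombination.1 h))
  choose P hP using fun (i j : Fin n) =>
    exists_polynomial_eval_eq_apply_add_smul_pow a b i (LinearMap.proj j ∘ₗ g)
  set D : Polynomial K := Matrix.det (Matrix.of P) with hD
  have hDt (t : K) : D.eval t =
      Matrix.det (Matrix.of fun i j : Fin n => g ((a + t • b) ^ (i : ℕ)) j) := by
    rw [hD, ← Polynomial.coe_evalRingHom, RingHom.map_det]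
    congr 1
    ext i j
    simp [hP]
  have hg₁ (i : Fin n) : g ((a + t₁ • b) ^ (i : ℕ)) = Pi.single i 1 := by
    have := LinearMap.congr_fun hg (Pi.single i 1)
    simpa using this
  have hD₁ : D.eval t₁ = 1 := by
    rw [hDt]
    convert Matrix.det_one (n := Fin n) (R := K)
    ext i j
    simp [hg₁, Matrix.one_apply, Pi.single_apply, eq_comm]
  have hD0 : D ≠ 0 := by
    rintro h0
    simp [h0] at hD₁
  refine (Polynomial.finite_setOfPred_isRoot hD0).subset fun t ht => ?_
  by_contra hroot
  refine ht ?_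
  have hdet : IsUnit (Matrix.of fun i j : Fin n => g ((a + t • b) ^ (i : ℕ)) j) := by
    rw [Matrix.isUnit_iff_isUnit_det, ← hDt]
    exact IsUnit.mk0 _ hroot
  exact (Matrix.linearIndependent_rows_of_isUnit hdet).of_comp g

/-- Over a locally compact field, linear dependence of the first powers is a closed condition. -/
theorem isClosed_setOf_not_linearIndependent_pow (K : Type*) {A : Type*}
    [NontriviallyNormedField K] [ProperSpace K] [Ring A] [Algebra K A] [TopologicalSpace A]
    [T2Space A] [IsTopologicalRing A] [ContinuousSMul K A] (n : ℕ) :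
    IsClosed {a : A | ¬ LinearIndependent K fun i : Fin n => a ^ (i : ℕ)} := by
  -- Relations can be scaled to sup norm `1`; projecting along the compact unit sphere is a closed
  -- map.
  let S := Metric.sphere (0 : Fin n → K) 1
  have : CompactSpace S := isCompact_iff_compactSpace.1 (isCompact_sphere _ _)
  have hcl : IsClosed {x : S × A | ∑ i, (x.1 : Fin n → K) i • x.2 ^ (i : ℕ) = 0} :=
    isClosed_eq (continuous_finsetSum _ fun i _ =>
      ((continuous_apply i).comp (continuous_subtype_val.comp continuous_fst)).smul
        (continuous_snd.pow _)) continuous_const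
  convert isClosedMap_snd_of_compactSpace _ hcl using 1
  ext a
  simp only [Set.mem_ofPred_eq, Set.mem_image, Prod.exists, exists_eq_right]
  constructor
  · intro h
    obtain ⟨c, hc, i, hi⟩ := Fintype.not_linearIndependent_iff.1 h
    obtain ⟨j, -, hj⟩ := Finset.exists_max_image Finset.univ (fun j => ‖c j‖) ⟨i, Finset.mem_univ i⟩
    have hcj : c j ≠ 0 := norm_pos_iff.1 ((norm_pos_iff.2 hi).trans_le (hj i (Finset.mem_univ i)))
    refine ⟨⟨(c j)⁻¹ • c, ?_⟩, ?_⟩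
    · have hle : ‖c‖ = ‖c j‖ := le_antisymm
        ((pi_norm_le_iff_of_nonneg (norm_nonneg _)).2 fun k => hj k (Finset.mem_univ k))
        (norm_le_pi_norm c j)
      simp [S, norm_smul, hle, hcj]
    · simp [mul_smul, ← Finset.smul_sum, hc]
  · rintro ⟨⟨c, hcS⟩, hc⟩
    refine Fintype.not_linearIndependent_iff.2 ⟨c, hc, ?_⟩
    by_contra! h0
    have : c = 0 := funext h0
    simp [S, this] at hcS

theorem not_linearIndependent_pow_of_natDegree_lt {K A : Type*} [Field K] [Ring A] [Algebra K A]
    {a : A} (ha : IsIntegral K a) {n : ℕ} (h : (minpoly K a).natDegree < n) :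
    ¬ LinearIndependent K fun i : Fin n => a ^ (i : ℕ) := by
  refine Fintype.not_linearIndependent_iff.2
    ⟨fun i => (minpoly K a).coeff i, ?_, ⟨_, h⟩, ?_⟩
  · rw [Fin.sum_univ_eq_sum_range fun i => (minpoly K a).coeff i • a ^ i,
      ← Polynomial.aeval_eq_sum_range' h, minpoly.aeval]
  · simp [minpoly.ne_zero ha]

/-- By Baire's theorem, the degrees of the elements of an algebraic, completely metrizable algebra
over a locally compact field are bounded. -/
theorem exists_natDegree_minpoly_le_of_baireSpace (K A : Type*)
    [NontriviallyNormedField K] [ProperSpace K] [Ring A] [Algebra K A] [TopologicalSpace A]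
    [T2Space A] [IsTopologicalRing A] [ContinuousSMul K A] [BaireSpace A]
    (halg : ∀ a : A, IsIntegral K a) :
    ∃ n, ∀ a : A, (minpoly K a).natDegree ≤ n := by
  obtain ⟨n, a, ha⟩ := nonempty_interior_of_iUnion_of_closed
    (fun n : ℕ => isClosed_setOf_not_linearIndependent_pow K (A := A) n)
    (Set.eq_univ_of_forall fun a => Set.mem_iUnion.2
      ⟨_, not_linearIndependent_pow_of_natDegree_lt (halg a) (Nat.lt_succ_self _)⟩)
  refine ⟨n, fun b => ?_⟩
  have hb : ¬ LinearIndependent K fun i : Fin n => b ^ (i : ℕ) := by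
    intro hb
    -- The line passes through `a` at `0` and `b` at `1`. Its finite exceptional set would contain a
    -- neighbourhood of `0`.
    have hfin := finite_setOf_not_linearIndependent_add_smul_pow a (b - a) n (1 : K) (by simpa)
    have hcont : Continuous fun t : K => a + t • (b - a) := by fun_prop
    have hnhds := hcont.continuousAt.preimage_mem_nhds (x := 0)
      (by simpa using mem_interior_iff_mem_nhds.1 ha)
    exact infinite_of_mem_nhds (0 : K) hnhds hfin
  by_contra! hlt
  exact hb ((linearIndependent_pow (K := K) b).comp (Fin.castLE hlt.le) (Fin.castLE_injective _))

/-- If a nontrivial relation `∑ c j * s * v j = 0` holds for all `s` in a multiplicative set, then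
the `v j` are linearly dependent over the centralizer of this set. -/
theorem exists_mem_centralizer_sum_mul_eq_zero {D ι : Type*} [DivisionRing D] [Fintype ι]
    (S : Submonoid D) (v c : ι → D) (hc0 : c ≠ 0) (hc : ∀ s ∈ S, ∑ j, c j * s * v j = 0) :
    ∃ e : ι → D, e ≠ 0 ∧ (∀ j, e j ∈ Set.centralizer (S : Set D)) ∧ ∑ j, e j * v j = 0 := by
  classical
  induction hn : (Finset.univ.filter fun j => c j ≠ 0).card using Nat.strong_induction_on
    generalizing c with
  | _ n ih =>
  subst hn
  obtain ⟨i, hi⟩ := Function.ne_iff.1 hc0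
  set b : ι → D := fun j => (c i)⁻¹ * c j with hb
  have hbi : b i = 1 := inv_mul_cancel₀ hi
  have hbS : ∀ s ∈ S, ∑ j, b j * s * v j = 0 := fun s hs => by
    simp only [hb, mul_assoc, ← Finset.mul_sum]
    simp only [← mul_assoc, hc s hs, mul_zero]
  by_cases hcen : ∀ j, b j ∈ Set.centralizer (S : Set D)
  · refine ⟨b, fun h => ?_, hcen, by simpa using hbS 1 S.one_mem⟩
    simp [h] at hbi
  · obtain ⟨j, hj⟩ := not_forall.1 hcen
    obtain ⟨s, hs, hne⟩ : ∃ s ∈ S, s * b j ≠ b j * s := by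
      simpa [Set.mem_centralizer_iff] using hj
    -- Subtracting the relation at `s * t` from `s` times the relation at `t` gives commutator
    -- coefficients; the one at `i` vanishes since `b i = 1`, so the support shrinks.
    refine ih _ ?_ (fun j => s * b j - b j * s) (fun h => hne ?_) (fun t ht => ?_) rfl
    · refine Finset.card_lt_card (Finset.ssubset_iff_of_subset ?_ |>.2 ⟨i, ?_, ?_⟩)
      · intro k
        simp only [Finset.mem_filter, Finset.mem_univ, true_and]
        contrapose!
        intro hk
        simp [hb, hk]
      · simpa using hi
      · simp [hbi]
    · exact sub_eq_zero.1 (congr_fun h j)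
    · have h₁ := hbS t ht
      have h₂ := hbS (s * t) (S.mul_mem hs ht)
      simp only [sub_mul, Finset.sum_sub_distrib, mul_assoc, ← Finset.mul_sum] at *
      simp [h₁, h₂]

open Module in
/-- A division algebra is finite-dimensional as soon as it contains a finite-dimensional subalgebra
with finite-dimensional centralizer. -/
theorem finiteDimensional_of_centralizer {K D : Type*} [Field K] [DivisionRing D] [Algebra K D]
    (S : Subalgebra K D) [FiniteDimensional K S]
    [FiniteDimensional K (Subalgebra.centralizer K (S : Set D))] :
    FiniteDimensional K D := by
  let C := Subalgebra.centralizer K (S : Set D)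
  let : DivisionRing C := divisionRingOfFiniteDimensional K C
  have hrank : Module.rank C D ≤ (finrank K S : ℕ) := by
    refine rank_le fun s hs => ?_
    by_contra! hlt
    let B := finBasis K S
    -- One left `D`-linear equation per basis vector of `S`: with more unknowns than equations, a
    -- nonzero solution `c` exists.
    let f : (s → D) →ₗ[D] (Fin (finrank K S) → D) := LinearMap.pi fun i =>
      ∑ j : s, (LinearMap.toSpanSingleton D D ((B i : D) * (j : D))) ∘ₗ LinearMap.proj j
    have hker := LinearMap.ker_ne_bot_of_finrank_lt (f := f) (by simpa using hlt)
    obtain ⟨c, hcf, hc0⟩ := Submodule.exists_mem_ne_zero_of_ne_bot hker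
    have hcB (i) : ∑ j : s, c j * (B i : D) * (j : D) = 0 := by
      simpa [f, mul_assoc] using congr_fun (LinearMap.mem_ker.1 hcf) i
    have hcS : ∀ x ∈ S.toSubmonoid, ∑ j : s, c j * x * (j : D) = 0 := by
      intro x hx
      let g : D →ₗ[K] D :=
        ∑ j : s, LinearMap.mulRight K (j : D) ∘ₗ LinearMap.mulLeft K (c j)
      have hg : g ∘ₗ S.val.toLinearMap = 0 := B.ext fun i => by simpa [g] using hcB i
      simpa [g] using LinearMap.congr_fun hg ⟨x, hx⟩
    obtain ⟨e, he0, heC, he⟩ := exists_mem_centralizer_sum_mul_eq_zero _ _ c hc0 hcS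
    refine he0 (funext fun j => ?_)
    have := Fintype.linearIndependent_iff.1 hs (fun j => (⟨e j, heC j⟩ : C))
      (by simpa [Subalgebra.smul_def] using he) j
    exact congr_arg Subtype.val this
  have : Module.Finite C D :=
    Module.rank_lt_aleph0_iff.1 (hrank.trans_lt Cardinal.natCast_lt_aleph0)
  exact Module.Finite.trans C D

open Module in
/-- In a division algebra that is integral over a perfect field, an element of maximal degree
generates a subalgebra that contains its own centralizer. -/
theorem mem_adjoin_singleton_of_commute {K D : Type*} [Field K] [PerfectField K] [DivisionRing D]
    [Algebra K D] (hint : ∀ a : D, IsIntegral K a) {x y : D}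
    (hx : ∀ a : D, (minpoly K a).natDegree ≤ (minpoly K x).natDegree) (hxy : Commute x y) :
    y ∈ Algebra.adjoin K {x} := by
  let F := Algebra.adjoin K {x, y}
  have hcomm : IsMulCommutative F := Algebra.isMulCommutative_adjoin K (by
    simp [hxy.eq])
  let : CommRing F := { (inferInstance : Ring F) with mul_comm := hcomm.is_comm.comm }
  have : Algebra.FiniteType K F :=
    F.fg_iff_finiteType.1 (Subalgebra.fg_def.2 ⟨_, Set.toFinite _, rfl⟩)
  have hintF : Algebra.IsIntegral K F :=
    ⟨fun a => (isIntegral_algHom_iff F.val Subtype.val_injective).1 (hint a)⟩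
  have : Module.Finite K F := Algebra.IsIntegral.finite
  have : IsDomain F := inferInstance
  let : Field F := (isField_of_isIntegral_of_isField' (Field.toIsField K)).toField
  -- The degree of `γ` is `[F : K]`, so maximality of the degree of `x` forces `F = K[x]`.
  obtain ⟨γ, hγ⟩ := Field.exists_primitive_element K F
  have hdeg := (Field.primitive_element_iff_minpoly_natDegree_eq K γ).1 hγ
  rw [← minpoly.algHom_eq F.val Subtype.val_injective γ] at hdeg
  have hle : Algebra.adjoin K {x} ≤ F := Algebra.adjoin_mono (by simp)
  have : FiniteDimensional K (Algebra.adjoin K {x}) :=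
    Module.Finite.of_fg (hint x).fg_adjoin_singleton
  have hcard : (minpoly K x).natDegree ≤ finrank K (Algebra.adjoin K {x}) := by
    have hli : LinearIndependent K fun i : Fin (minpoly K x).natDegree =>
        (⟨x ^ (i : ℕ), pow_mem (Algebra.self_mem_adjoin_singleton K x) _⟩ : Algebra.adjoin K {x}) :=
      (linearIndependent_pow (K := K) x).of_comp (Algebra.adjoin K {x}).val.toLinearMap
    simpa using hli.fintype_card_le_finrank
  have heq := Subalgebra.eq_of_le_of_finrank_le hle (hdeg.symm.le.trans ((hx _).trans hcard))
  rw [heq]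
  exact Algebra.subset_adjoin (by simp)

/-- A division algebra over a perfect field is finite-dimensional if its elements are integral of
bounded degree. -/
theorem finiteDimensional_of_natDegree_minpoly_le {K D : Type*} [Field K] [PerfectField K]
    [DivisionRing D] [Algebra K D] (hint : ∀ a : D, IsIntegral K a) {n : ℕ}
    (hn : ∀ a : D, (minpoly K a).natDegree ≤ n) : FiniteDimensional K D := by
  obtain ⟨_, ⟨x, rfl⟩, hx⟩ := Set.Finite.exists_maximal
    (s := Set.range fun a : D => (minpoly K a).natDegree) ((Set.finite_Iic n).subset (Set.range_subset_iff.2 hn)) (Set.range_nonempty _)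
  have hmax (a : D) : (minpoly K a).natDegree ≤ (minpoly K x).natDegree :=
    (le_total _ _).elim id (hx ⟨a, rfl⟩)
  have : FiniteDimensional K (Algebra.adjoin K {x}) :=
    Module.Finite.of_fg (hint x).fg_adjoin_singleton
  have hle : Subalgebra.centralizer K (Algebra.adjoin K {x} : Set D) ≤ Algebra.adjoin K {x} :=
    fun y hy => mem_adjoin_singleton_of_commute hint hmax
      (hy x (Algebra.self_mem_adjoin_singleton K x))
  have : FiniteDimensional K (Subalgebra.centralizer K (Algebra.adjoin K {x} : Set D)) :=
    FiniteDimensional.of_injective (Subalgebra.inclusion hle).toLinearMap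
      (Subalgebra.inclusion_injective hle)
  exact finiteDimensional_of_centralizer (Algebra.adjoin K {x})

theorem mainTheorem3 (p : ℕ) [Fact p.Prime]
    (L : Type*) [NormedField L] [NormedAlgebra ℚ_[p] L] [FiniteDimensional ℚ_[p] L]
    (A : Type*) [DivisionRing A] [Algebra L A] [UniformSpace A]
    (hA : IsFrechetAlgebra L A)
    (halg : ∀ a : A, IsAlgebraic L a) :
    FiniteDimensional L A := by
  obtain ⟨⟨_, _, _, q, -, hq⟩, _⟩ := hA
  let : NontriviallyNormedField L :=
    { ‹NormedField L› with
      non_trivial := by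
        obtain ⟨x, hx⟩ := NormedField.exists_one_lt_norm ℚ_[p]
        exact ⟨algebraMap ℚ_[p] L x, by rwa [norm_algebraMap']⟩ }
  have : ProperSpace L := FiniteDimensional.proper ℚ_[p] L
  have : CharZero L := charZero_of_injective_algebraMap (algebraMap ℚ_[p] L).injective
  have : ContinuousSMul L A := hq.continuousSMul
  have : FirstCountableTopology A := hq.firstCountableTopology
  -- Together with completeness, this makes `A` a Baire space.
  have : (uniformity A).IsCountablyGenerated := IsUniformAddGroup.uniformity_countably_generated
  have : IsTopologicalRing A := {}
  have hint (a : A) : IsIntegral L a := (halg a).isIntegral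
  obtain ⟨n, hn⟩ := exists_natDegree_minpoly_le_of_baireSpace L A hint
  exact finiteDimensional_of_natDegree_minpoly_le hint hn
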